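/- Let $\alpha=(\alpha_1,\dots,\alpha_n)$ be a composition (a finite sequence of positive integers), put $|\alpha|=\alpha_1+\cdots+\alpha_n$, and let $\delta_\alpha=(n^{\alpha_n},(n-1)^{\alpha_{n-1}},\dots,2^{\alpha_2},1^{\alpha_1})$ be the partition with exactly $\alpha_i$ parts equal to $i$ for each $1\le i\le n$. For partitions $\kappa\subseteq\rho$ let $s_{\rho/\kappa}=\sum_T x_1^{\#1\text{'s in }T}x_2^{\#2\text{'s in }T}\cdots$ be the skew Schur function, where $T$ runs over all semistandard Young tableaux of shape $\rho/\kappa$ with positive integer entries, and let $s_\nu=s_{\nu/\emptyset}$. The skew diagram $\rho/\kappa$ is called a sum of fat staircases if $s_{\rho/\kappa}$ is an integer linear combination of Schur functions $s_{\delta_\beta}$ with $\beta$ a composition. Theorem. Let $m$ be an integer with $1\le m<|\alpha|$. Then the skew diagram $\delta_\alpha/(1^m)$ (where $(1^m)$ is a single column of $m$ boxes) is a sum of fat staircases if and only if there is no $j\in\{1,\dots,n-1\}$ such that $\alpha_j\le m\le|\alpha|-\alpha_{j+1}$. -/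

import Mathlib

/-- The boxes of the skew diagram `lam / mu`, as pairs (row, column) counted from `0`, rows going
downwards (English notation, as for Mathlib's `YoungDiagram`). -/
def skewCells (lam mu : YoungDiagram) : Finset (ℕ × ℕ) := lam.cells \ mu.cells

/-- Semistandard Young tableaux of shape `lam / mu`: rows weakly increase, columns strictly increase.
As for Mathlib's `SemistandardYoungTableau`, the entries are taken in `{0, 1, 2, …}`
(the entry `k` stands for the positive integer `k + 1`), and `entry` is set to `0` outside the
shape so that equality of tableaux is equality of fillings. -/
@[ext]
structure SkewSSYT (lam mu : YoungDiagram) where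
  entry : ℕ → ℕ → ℕ
  row_weak : ∀ i j₁ j₂ : ℕ, j₁ < j₂ → (i, j₁) ∈ skewCells lam mu → (i, j₂) ∈ skewCells lam mu →
    entry i j₁ ≤ entry i j₂
  col_strict : ∀ i₁ i₂ j : ℕ, i₁ < i₂ → (i₁, j) ∈ skewCells lam mu → (i₂, j) ∈ skewCells lam mu →
    entry i₁ j < entry i₂ j
  zeros : ∀ i j : ℕ, (i, j) ∉ skewCells lam mu → entry i j = 0

/-- The content of a tableau: its value at `k` is the number of boxes that hold the entry `k`. -/
noncomputable def SkewSSYT.content {lam mu : YoungDiagram} (T : SkewSSYT lam mu) : ℕ →₀ ℕ :=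
  ∑ c ∈ skewCells lam mu, Finsupp.single (T.entry c.1 c.2) 1

/-- There are only finitely many tableaux of a given shape and content, so that the count in
`skewSchur` is a genuine one. -/
theorem SkewSSYT.finite_content (lam mu : YoungDiagram) (d : ℕ →₀ ℕ) :
    Finite {T : SkewSSYT lam mu // T.content = d} := by
  have hmem : ∀ (T : {T : SkewSSYT lam mu // T.content = d}) (c : skewCells lam mu),
      T.1.entry c.1.1 c.1.2 ∈ d.support := by
    rintro ⟨T, hT⟩ ⟨c, hc⟩
    change T.entry c.1 c.2 ∈ d.support
    rw [← hT, Finsupp.mem_support_iff, SkewSSYT.content, Finsupp.finset_sum_apply]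
    have h := Finset.single_le_sum
      (f := fun c' : ℕ × ℕ => (Finsupp.single (T.entry c'.1 c'.2) 1 : ℕ →₀ ℕ) (T.entry c.1 c.2))
      (fun _ _ => Nat.zero_le _) hc
    simp only [Finsupp.single_eq_same] at h
    exact Nat.one_le_iff_ne_zero.mp h
  refine Finite.of_injective
    (fun T => fun c : skewCells lam mu => (⟨T.1.entry c.1.1 c.1.2, hmem T c⟩ : d.support)) ?_
  intro T T' h
  apply Subtype.ext
  apply SkewSSYT.ext
  funext i j
  by_cases hc : (i, j) ∈ skewCells lam mu
  · exact congrArg Subtype.val (congrFun h ⟨(i, j), hc⟩)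
  · rw [T.1.zeros i j hc, T'.1.zeros i j hc]

/-- The skew Schur function `s_{lam / mu} = ∑_T x^{content T}`, the sum being over all semistandard
Young tableaux `T` of shape `lam / mu`, as a formal power series in infinitely many variables:
its coefficient at the monomial `x^d` is the number of such tableaux of content `d`. -/
noncomputable def skewSchur (lam mu : YoungDiagram) : MvPowerSeries ℕ ℤ :=
  fun d => (Nat.card {T : SkewSSYT lam mu // T.content = d} : ℤ)

/-- The Schur function `s_nu` of a partition. -/
noncomputable def schur (nu : YoungDiagram) : MvPowerSeries ℕ ℤ := skewSchur nu ⊥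

/-- The parts `(n^{α_n}, …, 2^{α_2}, 1^{α_1})`, for a composition `α = (α_1, …, α_n)`. -/
def fatStaircaseRows {N : ℕ} (α : Composition N) : List ℕ :=
  (List.finRange α.length).reverse.flatMap
    fun i => List.replicate (α.blocksFun i) ((i : ℕ) + 1)

theorem fatStaircaseRows_sorted {N : ℕ} (α : Composition N) : (fatStaircaseRows α).SortedGE := by
  rw [List.sortedGE_iff_pairwise, fatStaircaseRows, List.pairwise_flatMap]
  refine ⟨fun i _ => ?_, ?_⟩
  · rw [List.pairwise_replicate]
    exact Or.inr le_rfl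
  · rw [List.pairwise_reverse]
    refine (List.pairwise_lt_finRange α.length).imp ?_
    intro a b hab x hx y hy
    rw [List.eq_of_mem_replicate hx, List.eq_of_mem_replicate hy]
    have : (a : ℕ) < b := hab
    omega

/-- The fat staircase `δ_α`, the Ferrers diagram of the partition `(n^{α_n}, …, 2^{α_2}, 1^{α_1})`. -/
def fatStaircase {N : ℕ} (α : Composition N) : YoungDiagram :=
  YoungDiagram.ofRowLens (fatStaircaseRows α) (fatStaircaseRows_sorted α)

/-- The single column `(1^m)`. -/
def columnDiagram (m : ℕ) : YoungDiagram :=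
  YoungDiagram.ofRowLens (List.replicate m 1) (by
    rw [List.sortedGE_iff_pairwise, List.pairwise_replicate]
    exact Or.inr le_rfl)

/-- The skew diagram `lam / mu` is a sum of fat staircases: its skew Schur function is a linear
combination of Schur functions `s_nu` with `nu = δ_β` for compositions `β`. -/
def IsSumOfFatStaircases (lam mu : YoungDiagram) : Prop :=
  skewSchur lam mu ∈
    Submodule.span ℤ {f : MvPowerSeries ℕ ℤ | ∃ (k : ℕ) (β : Composition k), f = schur (fatStaircase β)}

/-! The dual Pieri rule (`skewSchur_columnDiagram`) writes $s_{\delta_\alpha/(1^m)}$ as the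
multiplicity-free sum of the $s_\nu$, where $\nu$ arises from $\delta_\alpha$ by removing a vertical
strip of $m$ boxes. Schur functions are linearly independent, so the question is whether every such
$\nu$ is a fat staircase, that is, has strictly decreasing nonzero column lengths
(`exists_eq_fatStaircase_iff`).

A vertical strip takes from each column $i$ any number of boxes from $0$ to $\alpha_i$,
independently of the other columns. Columns $j<n$ and $j+1$ end up with equal length exactly when
the former loses all $\alpha_j$ boxes and the latter none. The other columns can absorb any number
up to $|\alpha|-\alpha_j-\alpha_{j+1}$, so this occurs for some $\nu$ exactly when $\alpha_j\le
m\le|\alpha|-\alpha_{j+1}$.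

The Pieri rule is proved by counting tableaux by content. Peeling off the largest entry removes a
horizontal strip, and induction reduces the rule to the fact that removals of horizontal and
vertical strips commute (`card_removeStrips_comm`). -/

namespace YoungDiagram

/-! ### Young diagrams through their column lengths; strips -/

theorem ext_colLen {lam mu : YoungDiagram} (h : ∀ j, lam.colLen j = mu.colLen j) : lam = mu := by
  ext ⟨i, j⟩
  rw [mem_cells, mem_cells, mem_iff_lt_colLen, mem_iff_lt_colLen, h]

theorem le_iff_colLen {lam mu : YoungDiagram} : lam ≤ mu ↔ ∀ j, lam.colLen j ≤ mu.colLen j := by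
  constructor
  · intro h j
    by_contra! hlt
    exact lt_irrefl _ (mem_iff_lt_colLen.1 (h (mem_iff_lt_colLen.2 hlt)))
  · rintro h ⟨i, j⟩ hc
    exact mem_iff_lt_colLen.2 ((mem_iff_lt_colLen.1 hc).trans_le (h j))

theorem colLen_eq_zero {lam : YoungDiagram} {j : ℕ} (h : lam.rowLen 0 ≤ j) : lam.colLen j = 0 := by
  by_contra hne
  have := mem_iff_lt_rowLen.1 (mem_iff_lt_colLen.2 (Nat.pos_of_ne_zero hne))
  omega

@[simp]
theorem colLen_bot (j : ℕ) : (⊥ : YoungDiagram).colLen j = 0 := by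
  by_contra h
  exact notMem_bot _ (mem_iff_lt_colLen.2 (Nat.pos_of_ne_zero h))

theorem card_eq_sum_colLen (lam : YoungDiagram) {R : ℕ} (hR : lam.colLen R = 0) :
    lam.card = ∑ j ∈ Finset.range R, lam.colLen j := by
  rw [YoungDiagram.card, Finset.card_eq_sum_card_fiberwise (f := Prod.snd) (t := Finset.range R)]
  · exact Finset.sum_congr rfl fun j _ => (colLen_eq_card lam).symm
  · rintro ⟨i, j⟩ hc
    have h := mem_iff_lt_colLen.1 ((mem_cells _).1 hc)
    simp only [Finset.coe_range, Set.mem_Iio]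
    by_contra! hj
    have := lam.colLen_anti _ _ hj
    omega

/-- The Young diagram with prescribed column lengths, which vanish from the index `R` on. -/
def ofColLen (f : ℕ → ℕ) (hf : Antitone f) (R : ℕ) : YoungDiagram where
  -- Since `f` is antitone, this rectangle misses no cell once `f R = 0`, which only the lemmas
  -- about membership and column lengths require.
  cells := (Finset.range (f 0) ×ˢ Finset.range R).filter fun c => c.1 < f c.2
  isLowerSet := by
    rintro ⟨i, j⟩ ⟨i', j'⟩ ⟨hi, hj⟩ hc
    simp only [Finset.coe_filter, Finset.mem_product, Finset.mem_range, Set.mem_ofPred_eq] at *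
    have := hf hj
    omega

theorem mem_ofColLen {f : ℕ → ℕ} {hf : Antitone f} {R : ℕ} (hR : f R = 0) {i j : ℕ} :
    (i, j) ∈ ofColLen f hf R ↔ i < f j := by
  rw [← mem_cells]
  simp only [ofColLen, Finset.mem_filter, Finset.mem_product, Finset.mem_range]
  refine ⟨fun h => h.2, fun h => ⟨⟨h.trans_le (hf (Nat.zero_le j)), ?_⟩, h⟩⟩
  by_contra! hj
  have := hf hj
  omega

theorem colLen_ofColLen {f : ℕ → ℕ} {hf : Antitone f} {R : ℕ} (hR : f R = 0) (j : ℕ) :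
    (ofColLen f hf R).colLen j = f j :=
  eq_of_forall_lt_iff fun i => by rw [← mem_iff_lt_colLen, mem_ofColLen hR]

theorem finite_le (lam : YoungDiagram) : {rho : YoungDiagram | rho ≤ lam}.Finite := by
  refine Set.Finite.of_finite_image (f := YoungDiagram.cells) ?_ ?_
  · refine (lam.cells.powerset.finite_toSet).subset ?_
    rintro _ ⟨rho, h, rfl⟩
    exact Finset.mem_coe.2 (Finset.mem_powerset.2 h)
  · intro a _ b _ h
    exact YoungDiagram.ext h

open Classical in
/-- The diagrams obtained from `lam` by removing a horizontal strip with `a` boxes. -/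
noncomputable def removeHorizontalStrip (lam : YoungDiagram) (a : ℕ) : Finset YoungDiagram :=
  lam.finite_le.toFinset.filter fun rho =>
    (∀ j, lam.colLen j ≤ rho.colLen j + 1) ∧ lam.card = rho.card + a

open Classical in
/-- The diagrams obtained from `lam` by removing a vertical strip with `b` boxes. -/
noncomputable def removeVerticalStrip (lam : YoungDiagram) (b : ℕ) : Finset YoungDiagram :=
  lam.finite_le.toFinset.filter fun rho =>
    (∀ j, lam.colLen (j + 1) ≤ rho.colLen j) ∧ lam.card = rho.card + b

theorem mem_removeHorizontalStrip {lam rho : YoungDiagram} {a : ℕ} :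
    rho ∈ lam.removeHorizontalStrip a ↔
      (∀ j, rho.colLen j ≤ lam.colLen j ∧ lam.colLen j ≤ rho.colLen j + 1) ∧
        lam.card = rho.card + a := by
  simp [removeHorizontalStrip, le_iff_colLen, forall_and, and_assoc]

theorem mem_removeVerticalStrip {lam rho : YoungDiagram} {b : ℕ} :
    rho ∈ lam.removeVerticalStrip b ↔
      (∀ j, rho.colLen j ≤ lam.colLen j ∧ lam.colLen (j + 1) ≤ rho.colLen j) ∧
        lam.card = rho.card + b := by
  simp [removeVerticalStrip, le_iff_colLen, forall_and, and_assoc]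

end YoungDiagram

/-! ### Removals of horizontal and vertical strips commute -/

theorem Finset.card_filter_subset_powersetCard {F F' U : Finset ℕ} (hF : F ⊆ U) (hF' : F' ⊆ U)
    (h : F.card = F'.card) (a : ℕ) :
    ((U.powersetCard a).filter (F ⊆ ·)).card = ((U.powersetCard a).filter (F' ⊆ ·)).card := by
  -- Discarding the forced part `G` leaves a free choice of `a - G.card` elements of `U \ G`, so
  -- only the size of `G` matters.
  have key : ∀ G : Finset ℕ, G ⊆ U → ((U.powersetCard a).filter (G ⊆ ·)).card =
      if G.card ≤ a then (U.card - G.card).choose (a - G.card) else 0 := by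
    intro G hG
    split_ifs with hc
    · rw [← Finset.card_sdiff_of_subset hG, ← Finset.card_powersetCard]
      refine Finset.card_nbij' (· \ G) (· ∪ G) ?_ ?_ ?_ ?_
      · intro S hS
        simp only [coe_filter, mem_powersetCard, Set.mem_ofPred_eq, mem_coe] at hS ⊢
        exact ⟨sdiff_subset_sdiff hS.1.1 le_rfl, by rw [card_sdiff_of_subset hS.2, hS.1.2]⟩
      · intro S hS
        simp only [mem_powersetCard, Set.mem_ofPred_eq, mem_coe, coe_filter] at hS ⊢
        have hd : Disjoint S G := Finset.disjoint_left.2 fun x hx hg =>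
          (Finset.mem_sdiff.1 (hS.1 hx)).2 hg
        refine ⟨⟨union_subset (hS.1.trans sdiff_subset) hG, ?_⟩, subset_union_right⟩
        rw [card_union_of_disjoint hd, hS.2]
        omega
      · intro S hS
        simp only [coe_filter, Set.mem_ofPred_eq] at hS
        exact sdiff_union_of_subset hS.2
      · intro S hS
        simp only [mem_powersetCard, mem_coe] at hS
        have hd : Disjoint S G := Finset.disjoint_left.2 fun x hx hg =>
          (Finset.mem_sdiff.1 (hS.1 hx)).2 hg
        exact union_sdiff_cancel_right hd
    · rw [card_eq_zero, filter_eq_empty_iff]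
      intro S hS hGS
      have := card_le_card hGS
      rw [(mem_powersetCard.1 hS).2] at this
      exact hc this
  rw [key F hF, key F' hF', h]

namespace YoungDiagram

/-- A horizontal strip has at most one box per column, so it is encoded by the set of columns it
meets, and its size is the size of that set. -/
theorem card_add_card_eq {lam rho : YoungDiagram} {R : ℕ} (hR : lam.colLen R = 0)
    (h : ∀ j, rho.colLen j ≤ lam.colLen j ∧ lam.colLen j ≤ rho.colLen j + 1) :
    lam.card = rho.card + ((Finset.range R).filter fun j => rho.colLen j < lam.colLen j).card := by
  have hR' : rho.colLen R = 0 := by have := h R; omega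
  rw [card_eq_sum_colLen _ hR, card_eq_sum_colLen _ hR', Finset.card_filter,
    ← Finset.sum_add_distrib]
  refine Finset.sum_congr rfl fun j _ => ?_
  have := h j
  split_ifs <;> omega

open Classical in
/-- Removing a horizontal strip and removing a vertical strip commute. -/
theorem card_removeStrips_comm (lam nu : YoungDiagram) (a b : ℕ) :
    ((lam.removeHorizontalStrip a).filter fun rho => nu ∈ rho.removeVerticalStrip b).card =
      ((lam.removeVerticalStrip b).filter fun kap => nu ∈ kap.removeHorizontalStrip a).card := by
  by_cases hcard : lam.card = nu.card + a + b
  swap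
  · rw [Finset.filter_eq_empty_iff.2, Finset.filter_eq_empty_iff.2]
    · intro kap h1 h2
      rw [mem_removeVerticalStrip] at h1
      rw [mem_removeHorizontalStrip] at h2
      omega
    · intro kap h1 h2
      rw [mem_removeHorizontalStrip] at h1
      rw [mem_removeVerticalStrip] at h2
      omega
  -- These inequalities are forced by the existence of an intermediate diagram in either order;
  -- without them both counts are zero.
  by_cases hval : ∀ j, nu.colLen j ≤ lam.colLen j ∧ lam.colLen (j + 1) ≤ nu.colLen j + 1
  swap
  · rw [Finset.filter_eq_empty_iff.2, Finset.filter_eq_empty_iff.2]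
    · intro kap h1 h2
      rw [mem_removeVerticalStrip] at h1
      rw [mem_removeHorizontalStrip] at h2
      refine hval fun j => ?_
      have := h1.1 j
      have := h2.1 j
      omega
    · intro kap h1 h2
      rw [mem_removeHorizontalStrip] at h1
      rw [mem_removeVerticalStrip] at h2
      refine hval fun j => ?_
      have := h1.1 j
      have := h1.1 (j + 1)
      have := h2.1 j
      omega
  set R := lam.rowLen 0 + 1 with hRdef
  have hR0 : ∀ j, R ≤ j + 1 → lam.colLen j = 0 := fun j hj => colLen_eq_zero (by omega)
  have hR : lam.colLen R = 0 := hR0 R (by omega)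
  -- `U` holds the columns that may carry a box of the horizontal strip. `F` holds those that must
  -- carry one when that strip is removed first, `F'` those that must when it is removed last. The
  -- shift `j ↦ j - 1` maps `F` onto `F'`.
  set U := (Finset.range R).filter fun j => nu.colLen j < lam.colLen j with hU
  set F := (Finset.range R).filter fun j => 0 < j ∧ nu.colLen (j - 1) < lam.colLen j with hF
  set F' := (Finset.range R).filter fun j => nu.colLen j < lam.colLen (j + 1) with hF'
  have hFU : F ⊆ U := by
    intro j
    simp only [hF, hU, Finset.mem_filter, Finset.mem_range]
    rintro ⟨h1, h2, h3⟩
    have := nu.colLen_anti (j - 1) j (by omega)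
    exact ⟨h1, by omega⟩
  have hFU' : F' ⊆ U := by
    intro j
    simp only [hF', hU, Finset.mem_filter, Finset.mem_range]
    rintro ⟨h1, h2⟩
    have := lam.colLen_anti j (j + 1) (by omega)
    exact ⟨h1, by omega⟩
  have hFF : F.card = F'.card := by
    refine Finset.card_nbij' (· - 1) (· + 1) ?_ ?_ ?_ ?_
    · intro j
      simp only [hF, hF', Finset.coe_filter, Finset.mem_range, Set.mem_ofPred_eq]
      rintro ⟨h1, h2, h3⟩
      rw [Nat.sub_add_cancel h2]
      exact ⟨by omega, h3⟩
    · intro j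
      simp only [hF, hF', Finset.coe_filter, Finset.mem_range, Set.mem_ofPred_eq]
      rintro ⟨h1, h2⟩
      refine ⟨?_, by omega, by simpa using h2⟩
      by_contra! hj
      have := hR0 (j + 1) (by omega)
      omega
    · intro j
      simp only [hF, Finset.coe_filter, Set.mem_ofPred_eq]
      rintro ⟨h1, h2, h3⟩
      omega
    · intro j _
      simp
  have hmemU : ∀ S, S ∈ U.powersetCard a → (∀ j ∈ S, j < R ∧ nu.colLen j < lam.colLen j) ∧
      S.card = a := by
    intro S hS
    rw [Finset.mem_powersetCard] at hS
    exact ⟨fun j hj => by simpa [hU] using hS.1 hj, hS.2⟩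
  have h1 : ((lam.removeHorizontalStrip a).filter fun rho => nu ∈ rho.removeVerticalStrip b).card =
      ((U.powersetCard a).filter (F ⊆ ·)).card := by
    refine Finset.card_bij
      (fun rho _ => (Finset.range R).filter fun j => rho.colLen j < lam.colLen j) ?_ ?_ ?_
    · intro rho hrho
      simp only [Finset.mem_filter, mem_removeHorizontalStrip, mem_removeVerticalStrip] at hrho
      obtain ⟨⟨h1, h2⟩, h3, h4⟩ := hrho
      rw [Finset.mem_filter, Finset.mem_powersetCard]
      refine ⟨⟨?_, ?_⟩, ?_⟩
      · intro j
        simp only [hU, Finset.mem_filter]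
        rintro ⟨hj, hlt⟩
        have := h3 j
        exact ⟨hj, by omega⟩
      · have := card_add_card_eq hR h1
        omega
      · intro j
        simp only [hF, Finset.mem_filter]
        rintro ⟨hj, hpos, hlt⟩
        have := h3 (j - 1)
        rw [Nat.sub_add_cancel hpos] at this
        exact ⟨hj, by omega⟩
    · intro r1 hr1 r2 hr2 heq
      simp only [Finset.mem_filter, mem_removeHorizontalStrip] at hr1 hr2
      refine ext_colLen fun j => ?_
      have h1 := hr1.1.1 j
      have h2 := hr2.1.1 j
      by_cases hj : j < R
      · have := Finset.ext_iff.1 heq j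
        simp only [Finset.mem_filter, Finset.mem_range, hj, true_and] at this
        omega
      · have := hR0 j (by omega)
        omega
    · intro S hS
      rw [Finset.mem_filter] at hS
      obtain ⟨hS1, hS2⟩ := hmemU S hS.1
      have hSF : ∀ j, j + 1 ∉ S → lam.colLen (j + 1) ≤ nu.colLen j := by
        intro j hj
        by_contra! hlt
        refine hj (hS.2 ?_)
        simp only [hF, Finset.mem_filter, Finset.mem_range]
        refine ⟨?_, by omega, by simpa using hlt⟩
        by_contra! hj
        have := hR0 (j + 1) (by omega)
        omega
      -- The columns in `S` determine the intermediate diagram. The subtraction is genuine, as `lam`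
      -- is strictly longer than `nu` there.
      set f : ℕ → ℕ := fun j => if j ∈ S then lam.colLen j - 1 else lam.colLen j with hf
      have hfn : ∀ j, nu.colLen j ≤ f j ∧ f (j + 1) ≤ nu.colLen j := by
        intro j
        have h1 := hS1 j
        have h2 := hSF j
        have h3 := hval j
        simp only [hf]
        constructor
        · split_ifs with h
          · have := h1 h
            omega
          · omega
        · split_ifs with h
          · omega
          · exact h2 h
      have hfl : ∀ j, f j ≤ lam.colLen j ∧ lam.colLen j ≤ f j + 1 := by
        intro j
        simp only [hf]
        split_ifs <;> omega
      have hfS : ((Finset.range R).filter fun j => f j < lam.colLen j) = S := by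
        ext j
        simp only [Finset.mem_filter, Finset.mem_range, hf]
        constructor
        · rintro ⟨_, h⟩
          by_contra hj
          simp [hj] at h
        · intro h
          have := hS1 j h
          rw [if_pos h]
          omega
      have hrho : ∃ rho : YoungDiagram, ∀ j, rho.colLen j = f j :=
        ⟨ofColLen f (antitone_nat_of_succ_le fun j => (hfn j).2.trans (hfn j).1) R,
          colLen_ofColLen (by have := hfl R; omega)⟩
      obtain ⟨rho, hrho⟩ := hrho
      simp only [← hrho] at hfn hfl hfS
      have hc := card_add_card_eq hR hfl
      rw [hfS, hS2] at hc
      refine ⟨rho, ?_, hfS⟩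
      rw [Finset.mem_filter, mem_removeHorizontalStrip, mem_removeVerticalStrip]
      exact ⟨⟨hfl, hc⟩, hfn, by omega⟩
  have h2 : ((lam.removeVerticalStrip b).filter fun kap => nu ∈ kap.removeHorizontalStrip a).card =
      ((U.powersetCard a).filter (F' ⊆ ·)).card := by
    refine Finset.card_bij
      (fun rho _ => (Finset.range R).filter fun j => nu.colLen j < rho.colLen j) ?_ ?_ ?_
    · intro rho hrho
      simp only [Finset.mem_filter, mem_removeHorizontalStrip, mem_removeVerticalStrip] at hrho
      obtain ⟨⟨h1, h2⟩, h3, h4⟩ := hrho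
      rw [Finset.mem_filter, Finset.mem_powersetCard]
      refine ⟨⟨?_, ?_⟩, ?_⟩
      · intro j
        simp only [hU, Finset.mem_filter]
        rintro ⟨hj, hlt⟩
        have := h1 j
        exact ⟨hj, by omega⟩
      · have := card_add_card_eq (R := R) (by have := h1 R; omega) h3
        omega
      · intro j
        simp only [hF', Finset.mem_filter]
        rintro ⟨hj, hlt⟩
        have := h1 j
        exact ⟨hj, by omega⟩
    · intro r1 hr1 r2 hr2 heq
      simp only [Finset.mem_filter, mem_removeHorizontalStrip, mem_removeVerticalStrip] at hr1 hr2
      refine ext_colLen fun j => ?_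
      have h1 := hr1.2.1 j
      have h2 := hr2.2.1 j
      by_cases hj : j < R
      · have := Finset.ext_iff.1 heq j
        simp only [Finset.mem_filter, Finset.mem_range, hj, true_and] at this
        omega
      · have := hR0 j (by omega)
        have := hr1.1.1 j
        have := hr2.1.1 j
        omega
    · intro S hS
      rw [Finset.mem_filter] at hS
      obtain ⟨hS1, hS2⟩ := hmemU S hS.1
      have hSF : ∀ j, j ∉ S → lam.colLen (j + 1) ≤ nu.colLen j := by
        intro j hj
        by_contra! hlt
        refine hj (hS.2 ?_)
        simp only [hF', Finset.mem_filter, Finset.mem_range]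
        refine ⟨?_, hlt⟩
        by_contra! hj
        have := hR0 (j + 1) (by omega)
        omega
      -- In this order the horizontal strip is removed last, so the intermediate diagram is `nu`
      -- with one box added in each column of `S`.
      set f : ℕ → ℕ := fun j => if j ∈ S then nu.colLen j + 1 else nu.colLen j with hf
      have hfl : ∀ j, f j ≤ lam.colLen j ∧ lam.colLen (j + 1) ≤ f j := by
        intro j
        have h1 := hS1 j
        have h2 := hSF j
        have h3 := hval j
        simp only [hf]
        constructor
        · split_ifs with h
          · exact (h1 h).2
          · omega
        · split_ifs with h
          · omega
          · exact h2 h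
      have hfn : ∀ j, nu.colLen j ≤ f j ∧ f j ≤ nu.colLen j + 1 := by
        intro j
        simp only [hf]
        split_ifs <;> omega
      have hfS : ((Finset.range R).filter fun j => nu.colLen j < f j) = S := by
        ext j
        simp only [Finset.mem_filter, Finset.mem_range, hf]
        constructor
        · rintro ⟨_, h⟩
          by_contra hj
          simp [hj] at h
        · intro h
          have := hS1 j h
          rw [if_pos h]
          omega
      have hrho : ∃ rho : YoungDiagram, ∀ j, rho.colLen j = f j :=
        ⟨ofColLen f (antitone_nat_of_succ_le fun j => (hfl (j + 1)).1.trans (hfl j).2) R,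
          colLen_ofColLen (by have := hfl R; omega)⟩
      obtain ⟨rho, hrho⟩ := hrho
      simp only [← hrho] at hfn hfl hfS
      have hc := card_add_card_eq (R := R) (by have := hfl R; omega) hfn
      rw [hfS, hS2] at hc
      refine ⟨rho, ?_, hfS⟩
      rw [Finset.mem_filter, mem_removeHorizontalStrip, mem_removeVerticalStrip]
      exact ⟨⟨hfl, by omega⟩, hfn, hc⟩
  rw [h1, h2, Finset.card_filter_subset_powersetCard hFU hFU' hFF]

end YoungDiagram

/-! ### Peeling the largest entry off a skew tableau -/

theorem mem_skewCells {lam mu : YoungDiagram} {c : ℕ × ℕ} :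
    c ∈ skewCells lam mu ↔ c ∈ lam ∧ c ∉ mu := by
  simp [skewCells]

theorem card_skewCells {lam mu : YoungDiagram} (h : mu ≤ lam) :
    (skewCells lam mu).card + mu.card = lam.card := by
  rw [skewCells, Finset.card_sdiff_add_card_eq_card (YoungDiagram.cells_subset_iff.2 h)]

namespace SkewSSYT

variable {lam mu : YoungDiagram}

theorem content_apply (T : SkewSSYT lam mu) (k : ℕ) :
    T.content k = ((skewCells lam mu).filter fun c => T.entry c.1 c.2 = k).card := by
  rw [content, Finsupp.finsetSum_apply, Finset.card_filter]
  exact Finset.sum_congr rfl fun c _ => Finsupp.single_apply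

theorem content_entry_ne_zero (T : SkewSSYT lam mu) {c : ℕ × ℕ} (hc : c ∈ skewCells lam mu) :
    T.content (T.entry c.1 c.2) ≠ 0 := by
  rw [content_apply]
  exact Finset.card_ne_zero_of_mem (Finset.mem_filter.2 ⟨hc, rfl⟩)

/-- The boxes of `mu` together with the boxes of `T` whose entries are less than `n`. -/
def shapeBelow (T : SkewSSYT lam mu) (n : ℕ) : YoungDiagram where
  cells := mu.cells ∪ (skewCells lam mu).filter fun c => T.entry c.1 c.2 < n
  isLowerSet := by
    rintro ⟨i, j⟩ ⟨i', j'⟩ ⟨hi, hj⟩ hc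
    simp only [Finset.coe_union, Finset.coe_filter, Set.mem_union, Finset.mem_coe,
      YoungDiagram.mem_cells, Set.mem_ofPred_eq] at *
    by_cases hmu : (i', j') ∈ mu
    · exact Or.inl hmu
    · rcases hc with hc | ⟨hc, hlt⟩
      · exact absurd (mu.up_left_mem hi hj hc) hmu
      · refine Or.inr ?_
        have h1 := (mem_skewCells.1 hc).1
        have h2 : (i', j') ∈ skewCells lam mu :=
          mem_skewCells.2 ⟨lam.up_left_mem hi hj h1, hmu⟩
        -- The two cells are compared through the corner `(i', j)`, which avoids `mu` because `(i',
        -- j')` does.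
        have h3 : (i', j) ∈ skewCells lam mu :=
          mem_skewCells.2 ⟨lam.up_left_mem hi le_rfl h1,
            fun h => hmu (mu.up_left_mem le_rfl hj h)⟩
        refine ⟨h2, ?_⟩
        have h4 : T.entry i' j' ≤ T.entry i' j := by
          rcases hj.lt_or_eq with h | h
          · exact T.row_weak _ _ _ h h2 h3
          · exact le_of_eq (congrArg _ h)
        have h5 : T.entry i' j ≤ T.entry i j := by
          rcases hi.lt_or_eq with h | h
          · exact (T.col_strict _ _ _ h h3 hc).le
          · exact le_of_eq (congrArg (T.entry · j) h)
        exact (h4.trans h5).trans_lt hlt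

theorem mem_shapeBelow {T : SkewSSYT lam mu} {n : ℕ} {c : ℕ × ℕ} :
    c ∈ T.shapeBelow n ↔ c ∈ mu ∨ c ∈ skewCells lam mu ∧ T.entry c.1 c.2 < n := by
  rw [← YoungDiagram.mem_cells]
  simp [shapeBelow]

/-- The restriction of a tableau to a smaller outer shape. -/
def restrict (T : SkewSSYT lam mu) {rho : YoungDiagram} (h : rho ≤ lam) : SkewSSYT rho mu where
  entry i j := if (i, j) ∈ skewCells rho mu then T.entry i j else 0
  row_weak i j₁ j₂ hj h₁ h₂ := by
    rw [if_pos h₁, if_pos h₂]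
    rw [mem_skewCells] at h₁ h₂
    exact T.row_weak _ _ _ hj (mem_skewCells.2 ⟨h h₁.1, h₁.2⟩) (mem_skewCells.2 ⟨h h₂.1, h₂.2⟩)
  col_strict i₁ i₂ j hi h₁ h₂ := by
    rw [if_pos h₁, if_pos h₂]
    rw [mem_skewCells] at h₁ h₂
    exact T.col_strict _ _ _ hi (mem_skewCells.2 ⟨h h₁.1, h₁.2⟩) (mem_skewCells.2 ⟨h h₂.1, h₂.2⟩)
  zeros i j hc := if_neg hc

theorem notMem_of_colLen {rho : YoungDiagram} (hstrip : ∀ j, lam.colLen j ≤ rho.colLen j + 1)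
    {i₁ i₂ j : ℕ} (hi : i₁ < i₂) (h₁ : (i₁, j) ∉ rho) : (i₂, j) ∉ lam := by
  rw [YoungDiagram.mem_iff_lt_colLen] at h₁ ⊢
  have := hstrip j
  omega

/-- The extension of a tableau by a horizontal strip filled with a large entry. -/
def extend {rho : YoungDiagram} (T : SkewSSYT rho mu) (n : ℕ)
    (hstrip : ∀ j, lam.colLen j ≤ rho.colLen j + 1) (hmu : mu ≤ rho)
    (hrho : rho ≤ lam) (hn : ∀ c ∈ skewCells rho mu, T.entry c.1 c.2 < n) : SkewSSYT lam mu where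
  entry i j := if (i, j) ∈ skewCells rho mu then T.entry i j else
    if (i, j) ∈ skewCells lam rho then n else 0
  row_weak i j₁ j₂ hj h₁ h₂ := by
    rw [mem_skewCells] at h₁ h₂
    by_cases hc : (i, j₂) ∈ rho
    · have h3 := mem_skewCells.2 ⟨rho.up_left_mem le_rfl hj.le hc, h₁.2⟩
      have h4 := mem_skewCells.2 ⟨hc, h₂.2⟩
      rw [if_pos h3, if_pos h4]
      exact T.row_weak _ _ _ hj h3 h4
    · have h3 : (i, j₂) ∉ skewCells rho mu := fun h => hc (mem_skewCells.1 h).1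
      rw [if_neg h3, if_pos (mem_skewCells.2 ⟨h₂.1, hc⟩)]
      split_ifs with h4 h5
      · exact (hn _ h4).le
      · exact le_rfl
      · exact Nat.zero_le _
  col_strict i₁ i₂ j hi h₁ h₂ := by
    rw [mem_skewCells] at h₁ h₂
    by_cases hc : (i₂, j) ∈ rho
    · have h3 := mem_skewCells.2 ⟨rho.up_left_mem hi.le le_rfl hc, h₁.2⟩
      have h4 := mem_skewCells.2 ⟨hc, h₂.2⟩
      rw [if_pos h3, if_pos h4]
      exact T.col_strict _ _ _ hi h3 h4
    · have h3 : (i₂, j) ∉ skewCells rho mu := fun h => hc (mem_skewCells.1 h).1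
      rw [if_neg h3, if_pos (mem_skewCells.2 ⟨h₂.1, hc⟩)]
      by_cases h5 : (i₁, j) ∈ rho
      · rw [if_pos (mem_skewCells.2 ⟨h5, h₁.2⟩)]
        exact hn _ (mem_skewCells.2 ⟨h5, h₁.2⟩)
      · exact absurd h₂.1 (notMem_of_colLen hstrip hi h5)
  zeros i j hc := by
    rw [mem_skewCells] at hc
    rw [if_neg, if_neg]
    · exact fun h => hc ⟨(mem_skewCells.1 h).1, fun h' => (mem_skewCells.1 h).2 (hmu h')⟩
    · intro h
      rw [mem_skewCells] at h
      exact hc ⟨hrho h.1, h.2⟩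

theorem content_eq_add_single {rho : YoungDiagram} (hmu : mu ≤ rho) (hrho : rho ≤ lam)
    (T : SkewSSYT lam mu) (T' : SkewSSYT rho mu) (n : ℕ)
    (h : ∀ c ∈ skewCells rho mu, T.entry c.1 c.2 = T'.entry c.1 c.2)
    (hn : ∀ c ∈ skewCells lam rho, T.entry c.1 c.2 = n) :
    T.content = T'.content + Finsupp.single n (skewCells lam rho).card := by
  have hd : Disjoint (skewCells rho mu) (skewCells lam rho) := by
    rw [Finset.disjoint_left]
    intro c h1 h2
    exact (mem_skewCells.1 h2).2 (mem_skewCells.1 h1).1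
  have hu : skewCells lam mu = skewCells rho mu ∪ skewCells lam rho := by
    ext c
    have := @hmu c
    have := @hrho c
    simp only [Finset.mem_union, mem_skewCells]
    tauto
  rw [content, content, hu, Finset.sum_union hd]
  congr 1
  · exact Finset.sum_congr rfl fun c hc => by rw [h c hc]
  · rw [Finset.sum_congr rfl fun c hc => by rw [hn c hc], Finset.sum_const, Finsupp.smul_single,
      smul_eq_mul, mul_one]

/-- No entry exceeds `n`, so every box outside `shapeBelow n` holds `n`; strictness down columns
allows only one of them per column. -/
theorem shapeBelow_mem_removeHorizontalStrip {n : ℕ} {d : ℕ →₀ ℕ} (hd : ∀ k, n < k → d k = 0)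
    (hmu : mu ≤ lam) {T : SkewSSYT lam mu} (hT : T.content = d) :
    T.shapeBelow n ∈ lam.removeHorizontalStrip (d n) := by
  have hle : T.shapeBelow n ≤ lam := by
    intro c hc
    rcases mem_shapeBelow.1 hc with h | h
    · exact hmu h
    · exact (mem_skewCells.1 h.1).1
  have hent : ∀ c ∈ skewCells lam (T.shapeBelow n), c ∈ skewCells lam mu ∧ T.entry c.1 c.2 = n := by
    intro c hc
    rw [mem_skewCells, mem_shapeBelow, not_or, not_and] at hc
    have hc' := mem_skewCells.2 ⟨hc.1, hc.2.1⟩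
    have h1 := hc.2.2 hc'
    have h2 := T.content_entry_ne_zero hc'
    rw [hT] at h2
    have h3 : ¬ n < T.entry c.1 c.2 := fun h => h2 (hd _ h)
    exact ⟨hc', by omega⟩
  rw [YoungDiagram.mem_removeHorizontalStrip]
  refine ⟨fun j => ⟨YoungDiagram.le_iff_colLen.1 hle j, ?_⟩, ?_⟩
  · by_contra! hlt
    set r := (T.shapeBelow n).colLen j with hr
    have h1 : (r, j) ∈ skewCells lam (T.shapeBelow n) := by
      rw [mem_skewCells, YoungDiagram.mem_iff_lt_colLen, YoungDiagram.mem_iff_lt_colLen]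
      omega
    have h2 : (r + 1, j) ∈ skewCells lam (T.shapeBelow n) := by
      rw [mem_skewCells, YoungDiagram.mem_iff_lt_colLen, YoungDiagram.mem_iff_lt_colLen]
      omega
    have h3 := T.col_strict _ _ _ (Nat.lt_succ_self r) (hent _ h1).1 (hent _ h2).1
    have h4 := (hent _ h1).2
    have h5 := (hent _ h2).2
    simp only [Nat.succ_eq_add_one] at h3 h4 h5
    omega
  · rw [← card_skewCells hle, ← hT, content_apply, add_comm]
    congr 2
    ext c
    rw [Finset.mem_filter]
    refine ⟨hent c, fun ⟨h1, h2⟩ => ?_⟩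
    rw [mem_skewCells] at h1
    rw [mem_skewCells, mem_shapeBelow]
    exact ⟨h1.1, by have := h1.2; rintro (h | ⟨_, h⟩) <;> [exact this h; omega]⟩

theorem le_shapeBelow (T : SkewSSYT lam mu) (n : ℕ) : mu ≤ T.shapeBelow n :=
  fun _ hc => mem_shapeBelow.2 (Or.inl hc)

/-- Removing the boxes with the largest entry `n` from a tableau. -/
theorem card_fiber_shapeBelow {n : ℕ} {d : ℕ →₀ ℕ} (hd : ∀ k, n < k → d k = 0)
    {rho : YoungDiagram} (hmu : mu ≤ rho) (hrho : rho ∈ lam.removeHorizontalStrip (d n)) :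
    Nat.card {T : SkewSSYT lam mu // T.content = d ∧ T.shapeBelow n = rho} =
      Nat.card {T : SkewSSYT rho mu // T.content = d.erase n} := by
  rw [YoungDiagram.mem_removeHorizontalStrip] at hrho
  have hle : rho ≤ lam := YoungDiagram.le_iff_colLen.2 fun j => (hrho.1 j).1
  have hcard : (skewCells lam rho).card = d n := by
    have := card_skewCells hle
    omega
  have hlt : ∀ T : SkewSSYT rho mu, T.content = d.erase n →
      ∀ c ∈ skewCells rho mu, T.entry c.1 c.2 < n := by
    intro T hT c hc
    have h := T.content_entry_ne_zero hc
    rw [hT, Finsupp.erase_apply] at h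
    by_contra! hge
    split_ifs at h with h1
    · exact h rfl
    · exact h (hd _ (lt_of_le_of_ne hge (Ne.symm h1)))
  have hmono : ∀ c, c ∈ skewCells rho mu → c ∈ skewCells lam mu := fun c hc => by
    rw [mem_skewCells] at hc ⊢
    exact ⟨hle hc.1, hc.2⟩
  have hstrip := fun j => (hrho.1 j).2
  have hent : ∀ T : SkewSSYT lam mu, T.content = d → T.shapeBelow n = rho →
      ∀ c ∈ skewCells lam rho, T.entry c.1 c.2 = n := by
    rintro T hT hs c hc
    rw [← hs, mem_skewCells, mem_shapeBelow, not_or, not_and] at hc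
    have hc' := mem_skewCells.2 ⟨hc.1, hc.2.1⟩
    have h1 := hc.2.2 hc'
    have h2 := T.content_entry_ne_zero hc'
    rw [hT] at h2
    have h3 : ¬ n < T.entry c.1 c.2 := fun h => h2 (hd _ h)
    omega
  have hext : ∀ (T : SkewSSYT rho mu) (hT : T.content = d.erase n),
      (T.extend n hstrip hmu hle (hlt T hT)).content = d ∧
        (T.extend n hstrip hmu hle (hlt T hT)).shapeBelow n = rho := by
    intro T hT
    have h1 : ∀ c ∈ skewCells rho mu,
        (T.extend n hstrip hmu hle (hlt T hT)).entry c.1 c.2 = T.entry c.1 c.2 :=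
      fun c hc => if_pos hc
    have h2 : ∀ c ∈ skewCells lam rho,
        (T.extend n hstrip hmu hle (hlt T hT)).entry c.1 c.2 = n := fun c hc =>
      (if_neg fun h => (mem_skewCells.1 hc).2 (mem_skewCells.1 h).1).trans (if_pos hc)
    refine ⟨?_, ?_⟩
    · rw [content_eq_add_single hmu hle _ T n h1 h2, hT, hcard, Finsupp.erase_add_single]
    · ext c
      rw [YoungDiagram.mem_cells, YoungDiagram.mem_cells, mem_shapeBelow]
      constructor
      · rintro (h | ⟨h, hc⟩)
        · exact hmu h
        · by_contra hn
          rw [h2 c (mem_skewCells.2 ⟨(mem_skewCells.1 h).1, hn⟩)] at hc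
          exact lt_irrefl _ hc
      · intro h
        by_cases hm : c ∈ mu
        · exact Or.inl hm
        · have hc := mem_skewCells.2 ⟨h, hm⟩
          exact Or.inr ⟨hmono c hc, by rw [h1 c hc]; exact hlt T hT c hc⟩
  -- Restriction to `rho` and filling of the strip with `n` are mutually inverse.
  refine Nat.card_congr
    { toFun := fun T => ⟨T.1.restrict hle, ?_⟩
      invFun := fun T => ⟨T.1.extend n hstrip hmu hle (hlt T.1 T.2), hext T.1 T.2⟩
      left_inv := ?_
      right_inv := ?_ }
  · have h := content_eq_add_single hmu hle T.1 (T.1.restrict hle) n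
      (fun c hc => (if_pos hc).symm) (hent T.1 T.2.1 T.2.2)
    rw [T.2.1, hcard] at h
    exact add_right_cancel (h.symm.trans (Finsupp.erase_add_single n d).symm)
  · rintro ⟨T, hT, hs⟩
    refine Subtype.ext (SkewSSYT.ext ?_)
    funext i j
    change (if (i, j) ∈ skewCells rho mu then
      (if (i, j) ∈ skewCells rho mu then T.entry i j else 0) else
      if (i, j) ∈ skewCells lam rho then n else 0) = T.entry i j
    split_ifs with h1 h2
    · rfl
    · exact (hent T hT hs _ h2).symm
    · refine (T.zeros i j fun h => ?_).symm
      rw [mem_skewCells] at h h1 h2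
      tauto
  · rintro ⟨T, hT⟩
    refine Subtype.ext (SkewSSYT.ext ?_)
    funext i j
    change (if (i, j) ∈ skewCells rho mu then
      (if (i, j) ∈ skewCells rho mu then T.entry i j else
      if (i, j) ∈ skewCells lam rho then n else 0) else 0) = T.entry i j
    split_ifs with h1
    · rfl
    · exact (T.zeros i j h1).symm

theorem entry_eq_zero_of_le (h : lam ≤ mu) (T : SkewSSYT lam mu) (i j : ℕ) : T.entry i j = 0 :=
  T.zeros i j fun hc => (mem_skewCells.1 hc).2 (h (mem_skewCells.1 hc).1)

end SkewSSYT

/-! ### Skew Kostka numbers and the dual Pieri rule -/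

open Classical in
/-- The number of tableaux of shape `lam / mu` and content `d`, which is `0` unless `mu` is
contained in `lam`. -/
noncomputable def skewKostka (lam mu : YoungDiagram) (d : ℕ →₀ ℕ) : ℕ :=
  -- The set difference `skewCells` makes sense even if `mu` is not contained in `lam`. The value
  -- `0` there lets the branching sum run over all horizontal strips, including those that cut into
  -- `mu`.
  if mu ≤ lam then Nat.card {T : SkewSSYT lam mu // T.content = d} else 0

open Classical in
theorem skewKostka_zero (lam mu : YoungDiagram) :
    skewKostka lam mu 0 = if lam = mu then 1 else 0 := by
  rw [skewKostka]
  by_cases heq : lam = mu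
  · subst heq
    rw [if_pos le_rfl, if_pos rfl, Nat.card_eq_one_iff_unique]
    refine ⟨⟨fun a b => Subtype.ext (SkewSSYT.ext ?_)⟩, ⟨⟨0, ?_, ?_, ?_⟩, ?_⟩⟩
    · funext i j
      rw [a.1.entry_eq_zero_of_le le_rfl, b.1.entry_eq_zero_of_le le_rfl]
    · intros
      exact le_rfl
    · intro i₁ i₂ j _ h
      exact absurd h (by simp [skewCells])
    · intros
      rfl
    · simp [SkewSSYT.content, skewCells]
  · rw [if_neg heq]
    split_ifs with hle
    · rw [Nat.card_eq_zero]
      refine Or.inl ⟨fun ⟨T, hT⟩ => heq (le_antisymm ?_ hle)⟩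
      intro c hc
      by_contra hn
      have := T.content_entry_ne_zero (mem_skewCells.2 ⟨hc, hn⟩)
      rw [hT] at this
      exact this rfl
    · rfl

/-- The branching rule: removing the largest entry `n`. -/
theorem skewKostka_eq_sum {n : ℕ} {d : ℕ →₀ ℕ} (hd : ∀ k, n < k → d k = 0)
    (lam mu : YoungDiagram) :
    skewKostka lam mu d =
      ∑ rho ∈ lam.removeHorizontalStrip (d n), skewKostka rho mu (d.erase n) := by
  classical
  by_cases hmu : mu ≤ lam
  · have := SkewSSYT.finite_content lam mu d
    have := Fintype.ofFinite {T : SkewSSYT lam mu // T.content = d}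
    rw [skewKostka, if_pos hmu, Nat.card_eq_fintype_card, ← Finset.card_univ,
      Finset.card_eq_sum_card_fiberwise (f := fun T => T.1.shapeBelow n)
        (t := lam.removeHorizontalStrip (d n))
        (fun T _ => SkewSSYT.shapeBelow_mem_removeHorizontalStrip hd hmu T.2)]
    refine Finset.sum_congr rfl fun rho hrho => ?_
    rw [skewKostka]
    split_ifs with h
    · rw [← SkewSSYT.card_fiber_shapeBelow hd h hrho, ← Fintype.card_subtype,
        ← Nat.card_eq_fintype_card]
      exact Nat.card_congr (Equiv.subtypeSubtypeEquivSubtypeInter (fun T : SkewSSYT lam mu => T.content = d)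
        fun T => T.shapeBelow n = rho)
    · rw [Finset.card_eq_zero, Finset.filter_eq_empty_iff]
      rintro T _ rfl
      exact h (T.1.le_shapeBelow n)
  · rw [skewKostka, if_neg hmu, Finset.sum_eq_zero]
    intro rho hrho
    rw [YoungDiagram.mem_removeHorizontalStrip] at hrho
    rw [skewKostka, if_neg]
    exact fun h => hmu (h.trans (YoungDiagram.le_iff_colLen.2 fun j => (hrho.1 j).1))

theorem colLen_columnDiagram (m j : ℕ) : (columnDiagram m).colLen j = if j = 0 then m else 0 := by
  refine eq_of_forall_lt_iff fun i => ?_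
  rw [← YoungDiagram.mem_iff_lt_colLen, columnDiagram, YoungDiagram.mem_ofRowLens]
  simp only [List.getElem_replicate, List.length_replicate]
  split_ifs <;> simp <;> omega

open YoungDiagram in
-- The empty-content case of the dual Pieri rule.
theorem bot_mem_removeVerticalStrip_iff {lam : YoungDiagram} {m : ℕ} :
    ⊥ ∈ lam.removeVerticalStrip m ↔ lam = columnDiagram m := by
  rw [mem_removeVerticalStrip]
  constructor
  · rintro ⟨h1, h2⟩
    have h0 : ∀ j, lam.colLen (j + 1) = 0 := fun j => by simpa using (h1 j).2
    rw [card_eq_sum_colLen lam (h0 0)] at h2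
    refine ext_colLen fun j => ?_
    rw [colLen_columnDiagram]
    rcases j with _ | j
    · simpa [YoungDiagram.card] using h2
    · simpa using h0 j
  · rintro rfl
    refine ⟨fun j => ?_, ?_⟩
    · simp [colLen_columnDiagram]
    · rw [card_eq_sum_colLen (columnDiagram m) (R := 1) (by simp [colLen_columnDiagram])]
      simp [colLen_columnDiagram]

/-- Induction on the bound `n` for the entries. Branching on both sides leaves counts of two-step
chains from `lam` to `nu`, with the two kinds of strip removed in opposite orders; these counts
agree by commutation. -/
theorem skewKostka_columnDiagram (m n : ℕ) : ∀ (d : ℕ →₀ ℕ), (∀ k, n ≤ k → d k = 0) →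
    ∀ lam : YoungDiagram, skewKostka lam (columnDiagram m) d =
      ∑ nu ∈ lam.removeVerticalStrip m, skewKostka nu ⊥ d := by
  classical
  induction n with
  | zero =>
    intro d hd lam
    obtain rfl : d = 0 := Finsupp.ext fun k => hd k (Nat.zero_le k)
    simp_rw [skewKostka_zero, Finset.sum_ite_eq', bot_mem_removeVerticalStrip_iff]
  | succ n ih =>
    intro d hd lam
    have hd' : ∀ k, n < k → d k = 0 := hd
    have he : ∀ k, n ≤ k → d.erase n k = 0 := by
      intro k hk
      rw [Finsupp.erase_apply]
      split_ifs with h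
      · rfl
      · exact hd k (lt_of_le_of_ne hk (Ne.symm h))
    rw [skewKostka_eq_sum hd']
    simp_rw [skewKostka_eq_sum hd' _ ⊥, ih _ he]
    -- Exchanging the sums turns the coefficient of each `nu` into a number of intermediate
    -- diagrams. Letting `nu` range over all subdiagrams of `lam` gives both orders the same index
    -- set.
    have hsub : ∀ (A : Finset YoungDiagram) (B : YoungDiagram → Finset YoungDiagram),
        (∀ rho ∈ A, rho ≤ lam) → (∀ rho, ∀ nu ∈ B rho, nu ≤ rho) →
        ∑ rho ∈ A, ∑ nu ∈ B rho, skewKostka nu ⊥ (d.erase n) =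
          ∑ nu ∈ lam.finite_le.toFinset,
            (A.filter fun rho => nu ∈ B rho).card * skewKostka nu ⊥ (d.erase n) := by
      intro A B hA hB
      simp_rw [Finset.card_filter, Finset.sum_mul]
      rw [Finset.sum_comm]
      refine Finset.sum_congr rfl fun rho hrho => ?_
      simp_rw [ite_mul, one_mul, zero_mul]
      rw [← Finset.sum_filter]
      refine Finset.sum_congr ?_ fun _ _ => rfl
      ext nu
      simp only [Finset.mem_filter, Set.Finite.mem_toFinset, Set.mem_ofPred_eq]
      exact ⟨fun h => ⟨(hB _ _ h).trans (hA _ hrho), h⟩, fun h => h.2⟩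
    have hH : ∀ (a : ℕ) (rho nu : YoungDiagram), nu ∈ rho.removeHorizontalStrip a → nu ≤ rho :=
      fun a rho nu h => YoungDiagram.le_iff_colLen.2 fun j =>
        ((YoungDiagram.mem_removeHorizontalStrip.1 h).1 j).1
    have hV : ∀ (a : ℕ) (rho nu : YoungDiagram), nu ∈ rho.removeVerticalStrip a → nu ≤ rho :=
      fun a rho nu h => YoungDiagram.le_iff_colLen.2 fun j =>
        ((YoungDiagram.mem_removeVerticalStrip.1 h).1 j).1
    rw [hsub _ _ (hH _ lam) (hV _), hsub _ _ (hV _ lam) (hH _)]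
    exact Finset.sum_congr rfl fun nu _ => by rw [YoungDiagram.card_removeStrips_comm]

/-- The dual Pieri rule, in its skew form. -/
theorem skewSchur_columnDiagram {lam : YoungDiagram} {m : ℕ} (h : columnDiagram m ≤ lam) :
    skewSchur lam (columnDiagram m) = ∑ nu ∈ lam.removeVerticalStrip m, schur nu := by
  ext d
  rw [map_sum]
  have hd : ∀ k, d.support.sup id + 1 ≤ k → d k = 0 := by
    intro k hk
    by_contra hne
    have := Finset.le_sup (f := id) (Finsupp.mem_support_iff.2 hne)
    simp only [id] at this
    omega
  have := skewKostka_columnDiagram m _ d hd lam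
  simp only [skewKostka, if_pos h, bot_le, if_true] at this
  change (Nat.card _ : ℤ) = ∑ nu ∈ _, (Nat.card _ : ℤ)
  rw [this, Nat.cast_sum]

/-! ### Linear independence of Schur functions -/

open YoungDiagram

/-- The tableau of straight shape whose entries in row `i` all equal `i`. -/
def superstandard (lam : YoungDiagram) : SkewSSYT lam ⊥ where
  entry i j := if (i, j) ∈ skewCells lam ⊥ then i else 0
  row_weak i j₁ j₂ _ h₁ h₂ := by rw [if_pos h₁, if_pos h₂]
  col_strict i₁ i₂ j hi h₁ h₂ := by rwa [if_pos h₁, if_pos h₂]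
  zeros i j hc := if_neg hc

theorem content_superstandard (lam : YoungDiagram) (k : ℕ) :
    (superstandard lam).content k = lam.rowLen k := by
  rw [SkewSSYT.content_apply, rowLen_eq_card]
  congr 1
  ext c
  rw [Finset.mem_filter, mem_row_iff]
  have hc : c ∈ skewCells lam ⊥ ↔ c ∈ lam := by simp [mem_skewCells]
  rw [hc]
  refine and_congr_right fun h => ?_
  change (if (c.1, c.2) ∈ skewCells lam ⊥ then c.1 else 0) = k ↔ _
  rw [if_pos (hc.2 h)]

theorem SkewSSYT.le_entry {lam : YoungDiagram} (T : SkewSSYT lam ⊥) (j i : ℕ)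
    (hc : (i, j) ∈ lam) : i ≤ T.entry i j := by
  induction i with
  | zero => exact Nat.zero_le _
  | succ i ih =>
    have hc' := lam.up_left_mem (Nat.le_succ i) le_rfl hc
    have := T.col_strict _ _ _ (Nat.lt_succ_self i) (mem_skewCells.2 ⟨hc', notMem_bot _⟩)
      (mem_skewCells.2 ⟨hc, notMem_bot _⟩)
    have := ih hc'
    simp only [Nat.succ_eq_add_one] at *
    omega

/-- By `le_entry`, entries less than `k` lie in the first `k` rows; hence the shape dominates the
content. -/
theorem SkewSSYT.sum_content_le {lam : YoungDiagram} (T : SkewSSYT lam ⊥) (k : ℕ) :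
    ∑ i ∈ Finset.range k, T.content i ≤ ∑ i ∈ Finset.range k, lam.rowLen i := by
  simp_rw [SkewSSYT.content_apply, rowLen_eq_card]
  have h1 : ∑ i ∈ Finset.range k,
      ((skewCells lam ⊥).filter fun c => T.entry c.1 c.2 = i).card =
      ((skewCells lam ⊥).filter fun c => T.entry c.1 c.2 < k).card := by
    rw [Finset.card_eq_sum_card_fiberwise (f := fun c => T.entry c.1 c.2) (t := Finset.range k)]
    · refine Finset.sum_congr rfl fun i hi => ?_
      rw [Finset.filter_filter]
      congr 1
      refine Finset.filter_congr fun c _ => ?_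
      rw [Finset.mem_range] at hi
      omega
    · intro c hc
      simp only [Finset.coe_filter, Set.mem_ofPred_eq] at hc
      simpa using hc.2
  have h2 : ∑ i ∈ Finset.range k, (lam.row i).card =
      (lam.cells.filter fun c => c.1 < k).card := by
    rw [Finset.card_eq_sum_card_fiberwise (f := Prod.fst) (t := Finset.range k)]
    · refine Finset.sum_congr rfl fun i hi => ?_
      rw [Finset.filter_filter, row]
      congr 1
      refine Finset.filter_congr fun c _ => ?_
      rw [Finset.mem_range] at hi
      omega
    · intro c hc
      simp only [Finset.coe_filter, Set.mem_ofPred_eq] at hc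
      simpa using hc.2
  rw [h1, h2]
  refine Finset.card_le_card fun c => ?_
  simp only [Finset.mem_filter, mem_skewCells, mem_cells]
  rintro ⟨⟨h, _⟩, hlt⟩
  exact ⟨h, (T.le_entry _ _ h).trans_lt hlt⟩

/-- Schur functions are linearly independent, by triangularity in the dominance order. -/
theorem linearIndependent_schur : LinearIndependent ℤ schur := by
  classical
  rw [linearIndependent_iff']
  intro s g hg
  by_contra! hne
  obtain ⟨lam₀, hlam₀⟩ := hne
  -- Take `mu` dominance-maximal among the shapes with nonzero coefficient. Any other such shape
  -- contributing to the monomial of `superstandard mu` would dominate `mu`, hence have the same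
  -- partial row sums and equal it.
  obtain ⟨mu, hmax⟩ := Finset.exists_maximalFor
    (fun (lam : YoungDiagram) (k : ℕ) => ∑ i ∈ Finset.range k, lam.rowLen i) (s.filter (g · ≠ 0))
    ⟨lam₀, Finset.mem_filter.2 hlam₀⟩
  obtain ⟨hmu, hmax⟩ := hmax
  rw [Finset.mem_filter] at hmu
  have hcoeff := congrArg (MvPowerSeries.coeff (superstandard mu).content) hg
  rw [map_sum, map_zero, Finset.sum_eq_single_of_mem mu hmu.1] at hcoeff
  · rw [map_smul, smul_eq_mul, mul_eq_zero] at hcoeff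
    refine hcoeff.elim hmu.2 fun h => ?_
    have h' : Nat.card {T : SkewSSYT mu ⊥ // T.content = (superstandard mu).content} = 0 := by
      exact Int.natCast_eq_zero.1 h
    have := SkewSSYT.finite_content mu ⊥ (superstandard mu).content
    rw [Nat.card_eq_zero] at h'
    exact h'.elim (fun h => h.elim ⟨superstandard mu, rfl⟩) (fun h => this.not_infinite h)
  · intro lam hlam hne
    by_contra hprod
    rw [map_smul, smul_eq_mul, mul_eq_zero, not_or] at hprod
    have h' : Nat.card {T : SkewSSYT lam ⊥ // T.content = (superstandard mu).content} ≠ 0 := by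
      exact fun h => hprod.2 (Int.natCast_eq_zero.2 h)
    obtain ⟨⟨T, hT⟩⟩ := (Nat.card_ne_zero.1 h').1
    have hle : ∀ k, ∑ i ∈ Finset.range k, mu.rowLen i ≤ ∑ i ∈ Finset.range k, lam.rowLen i := by
      intro k
      have := T.sum_content_le k
      rw [hT] at this
      simpa only [content_superstandard] using this
    have hge := hmax (Finset.mem_filter.2 ⟨hlam, hprod.1⟩) hle
    refine hne ?_
    rw [← transpose_eq_iff]
    refine ext_colLen fun j => ?_
    rw [colLen_transpose, colLen_transpose]
    have h1 := le_antisymm (hle j) (hge j)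
    have h2 := le_antisymm (hle (j + 1)) (hge (j + 1))
    rw [Finset.sum_range_succ, Finset.sum_range_succ] at h2
    omega

/-- Expansions in Schur functions are unique, and each `nu` in `V` has coefficient `1`, so none can
cancel. -/
theorem sum_schur_mem_span_iff (V : Finset YoungDiagram) (F : Set YoungDiagram) :
    ∑ nu ∈ V, schur nu ∈ Submodule.span ℤ (schur '' F) ↔ ↑V ⊆ F := by
  classical
  constructor
  · intro h nu hnu
    obtain ⟨l, hl, heq⟩ := (Finsupp.mem_span_image_iff_linearCombination ℤ).1 h
    have hl' : l = ∑ nu ∈ V, Finsupp.single nu 1 := by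
      refine linearIndependent_schur ?_
      rw [heq, map_sum]
      simp
    refine hl (Finset.mem_coe.2 (Finsupp.mem_support_iff.2 ?_))
    rw [hl', Finsupp.finsetSum_apply]
    simp only [Finsupp.single_apply, Finset.sum_ite_eq']
    rw [if_pos (Finset.mem_coe.1 hnu)]
    exact one_ne_zero
  · intro h
    exact Submodule.sum_mem _ fun nu hnu => Submodule.subset_span ⟨nu, h hnu, rfl⟩

/-! ### Column lengths of fat staircases -/

theorem List.lt_getElem_iff_lt_countP {w : List ℕ} (hw : w.Pairwise (· ≥ ·)) (i j : ℕ) :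
    (∃ h : i < w.length, j < w[i]) ↔ i < w.countP (j < ·) := by
  induction w generalizing i with
  | nil => simp
  | cons a w ih =>
    rw [List.pairwise_cons] at hw
    by_cases ha : j < a
    · rw [List.countP_cons_of_pos (by simpa using ha)]
      rcases i with _ | i
      · simpa using ha
      · simpa using ih hw.2 i
    · have h0 : (a :: w).countP (j < ·) = 0 := by
        rw [List.countP_eq_zero]
        intro b hb
        rcases List.mem_cons.1 hb with rfl | hb
        · simpa using ha
        · have := hw.1 b hb
          simp only [decide_eq_true_eq]
          omega
      rw [h0]
      refine ⟨fun ⟨h, hlt⟩ => ?_, fun h => absurd h (Nat.not_lt_zero _)⟩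
      have hm := List.getElem_mem h
      rw [List.countP_eq_zero] at h0
      exact absurd hlt (by simpa using h0 _ hm)

theorem sizeUpTo_add_sum {N : ℕ} (α : Composition N) (j : ℕ) :
    α.sizeUpTo j + ∑ i : Fin α.length, (if j ≤ i then α.blocksFun i else 0) = N := by
  induction j with
  | zero => simp [α.sum_blocksFun]
  | succ j ih =>
    by_cases hj : j < α.length
    · have h := Finset.sum_ite_eq' Finset.univ (⟨j, hj⟩ : Fin α.length) α.blocksFun
      rw [if_pos (Finset.mem_univ _)] at h
      refine Eq.trans ?_ ih
      rw [α.sizeUpTo_succ' ⟨j, hj⟩, ← h, add_assoc, ← Finset.sum_add_distrib]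
      congr 1
      refine Finset.sum_congr rfl fun i _ => ?_
      simp only [Fin.ext_iff]
      split_ifs <;> omega
    · rw [α.sizeUpTo_ofLength_le _ (by omega)]
      simp only [Nat.add_eq_left, Finset.sum_eq_zero_iff]
      intro i _
      rw [if_neg (by omega)]

/-- With columns numbered from `0`, column `j` meets the rows of length greater than `j`, which come
from the blocks of index at least `j`. -/
theorem colLen_fatStaircase {N : ℕ} (α : Composition N) (j : ℕ) :
    (fatStaircase α).colLen j = N - α.sizeUpTo j := by
  have h1 : (fatStaircase α).colLen j = (fatStaircaseRows α).countP (j < ·) := by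
    refine eq_of_forall_lt_iff fun i => ?_
    rw [← List.lt_getElem_iff_lt_countP
      (List.sortedGE_iff_pairwise.1 (fatStaircaseRows_sorted α)), ← mem_iff_lt_colLen,
      fatStaircase, mem_ofRowLens]
  have h2 : (fatStaircaseRows α).countP (j < ·) =
      ∑ i : Fin α.length, (if j ≤ i then α.blocksFun i else 0) := by
    rw [fatStaircaseRows, List.countP_flatMap, List.map_reverse, List.sum_reverse,
      ← List.ofFn_eq_map, List.sum_ofFn]
    refine Finset.sum_congr rfl fun i _ => ?_
    simp [List.countP_replicate]
  rw [h1, h2, ← Nat.add_left_cancel_iff (n := α.sizeUpTo j), sizeUpTo_add_sum,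
    Nat.add_sub_cancel' (α.sizeUpTo_le j)]

/-- The blocks of `β` are the drops between consecutive column lengths, and strict decrease is
exactly their positivity. -/
theorem exists_eq_fatStaircase_iff (D : YoungDiagram) :
    (∃ (k : ℕ) (β : Composition k), D = fatStaircase β) ↔
      ∀ j, 0 < D.colLen j → D.colLen (j + 1) < D.colLen j := by
  constructor
  · rintro ⟨k, β, rfl⟩ j hj
    rw [colLen_fatStaircase] at hj ⊢
    rw [colLen_fatStaircase]
    by_cases hlt : j < β.length
    · have := β.sizeUpTo_strict_mono hlt
      omega
    · rw [β.sizeUpTo_ofLength_le j (by omega)] at hj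
      omega
  · intro h
    have hsum : ∀ j, ((List.range j).map fun i => D.colLen i - D.colLen (i + 1)).sum =
        D.colLen 0 - D.colLen j := by
      intro j
      induction j with
      | zero => simp
      | succ j ih =>
        rw [List.range_succ, List.map_append, List.sum_append, ih]
        have := D.colLen_anti 0 j (Nat.zero_le j)
        have := D.colLen_anti j (j + 1) (by omega)
        simp only [List.map_cons, List.map_nil, List.sum_cons, List.sum_nil]
        omega
    refine ⟨D.colLen 0, ⟨(List.range (D.rowLen 0)).map fun i => D.colLen i - D.colLen (i + 1),
      ?_, ?_⟩, ?_⟩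
    · intro x hx
      rw [List.mem_map] at hx
      obtain ⟨i, hi, rfl⟩ := hx
      rw [List.mem_range, ← mem_iff_lt_rowLen, mem_iff_lt_colLen] at hi
      have := h i hi
      omega
    · rw [hsum, colLen_eq_zero le_rfl, Nat.sub_zero]
    · refine ext_colLen fun j => ?_
      rw [colLen_fatStaircase, Composition.sizeUpTo]
      simp only [← List.map_take, List.take_range]
      rw [hsum]
      have := D.colLen_anti 0 (min j (D.rowLen 0)) (Nat.zero_le _)
      rcases le_total j (D.rowLen 0) with hj | hj
      · rw [min_eq_left hj] at *
        omega
      · rw [min_eq_right hj, colLen_eq_zero le_rfl, colLen_eq_zero hj]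
        omega

/-! ### The numerical criterion -/

theorem Finset.exists_le_sum_eq {ι : Type*} [DecidableEq ι] (s : Finset ι) (c : ι → ℕ) (t : ℕ)
    (ht : t ≤ ∑ i ∈ s, c i) : ∃ g : ι → ℕ, (∀ i, g i ≤ c i) ∧ ∑ i ∈ s, g i = t := by
  induction t with
  | zero => exact ⟨0, fun _ => Nat.zero_le _, by simp⟩
  | succ t ih =>
    obtain ⟨g, hg, hsum⟩ := ih (by omega)
    obtain ⟨i, hi, hlt⟩ := Finset.exists_lt_of_sum_lt (s := s) (f := g) (g := c) (by omega)
    refine ⟨g + Pi.single i 1, fun k => ?_, ?_⟩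
    · have := hg k
      by_cases hk : k = i
      · subst hk
        simpa using hlt
      · simpa [Pi.single_eq_of_ne hk] using this
    · simp only [Pi.add_apply, Finset.sum_add_distrib, Finset.sum_pi_single', if_pos hi, hsum]

theorem colLen_fatStaircase_succ {N : ℕ} (α : Composition N) (j : Fin α.length) :
    (fatStaircase α).colLen j = (fatStaircase α).colLen (j + 1) + α.blocksFun j := by
  have h1 := α.sizeUpTo_succ' j
  have h2 := α.sizeUpTo_le (j + 1)
  rw [colLen_fatStaircase, colLen_fatStaircase]
  omega

theorem theorem4p7 {N : ℕ} (α : Composition N) (m : ℕ) (hm : 1 ≤ m) (hmN : m < N) :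
    IsSumOfFatStaircases (fatStaircase α) (columnDiagram m) ↔
      ¬ ∃ (j : ℕ) (hj : j + 1 < α.length),
        α.blocksFun ⟨j, Nat.lt_of_succ_lt hj⟩ ≤ m ∧ m ≤ N - α.blocksFun ⟨j + 1, hj⟩ := by
  have hN : (fatStaircase α).colLen 0 = N := by simp [colLen_fatStaircase]
  have hle : columnDiagram m ≤ fatStaircase α := by
    rw [le_iff_colLen]
    intro j
    rw [colLen_columnDiagram]
    split_ifs with h
    · subst h
      omega
    · exact Nat.zero_le _
  have hset : {f : MvPowerSeries ℕ ℤ | ∃ (k : ℕ) (β : Composition k), f = schur (fatStaircase β)} =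
      schur '' {D | ∃ (k : ℕ) (β : Composition k), D = fatStaircase β} := by
    ext f
    constructor
    · rintro ⟨k, β, rfl⟩
      exact ⟨_, ⟨k, β, rfl⟩, rfl⟩
    · rintro ⟨_, ⟨k, β, rfl⟩, rfl⟩
      exact ⟨k, β, rfl⟩
  rw [IsSumOfFatStaircases, hset, skewSchur_columnDiagram hle, sum_schur_mem_span_iff]
  have hlen : (fatStaircase α).colLen α.length = 0 := by simp [colLen_fatStaircase]
  have hblock := colLen_fatStaircase_succ α
  set lam := fatStaircase α
  have hanti : ∀ j, lam.colLen (j + 1) ≤ lam.colLen j := fun j => lam.colLen_anti _ _ (by omega)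
  -- The drop at column `i` is the most a vertical strip can take from it; these capacities add up
  -- to `N`.
  have htel : ∑ i ∈ Finset.range α.length, (lam.colLen i - lam.colLen (i + 1)) = N := by
    have h : ∀ R, ∑ i ∈ Finset.range R, (lam.colLen i - lam.colLen (i + 1)) + lam.colLen R = N := by
      intro R
      induction R with
      | zero => simpa using hN
      | succ R ih =>
        have := hanti R
        rw [Finset.sum_range_succ]
        omega
    simpa [hlen] using h α.length
  constructor
  · rintro hfat ⟨j, hj, h1, h2⟩
    have hb1 := hblock ⟨j, Nat.lt_of_succ_lt hj⟩
    have hb2 := hblock ⟨j + 1, hj⟩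
    have hpos : 0 < α.blocksFun ⟨j + 1, hj⟩ := α.one_le_blocksFun _
    simp only at hb1 hb2
    set p := α.blocksFun ⟨j, Nat.lt_of_succ_lt hj⟩
    set q := α.blocksFun ⟨j + 1, hj⟩
    have hsum : ∑ i ∈ Finset.range α.length,
        (if i = j ∨ i = j + 1 then 0 else lam.colLen i - lam.colLen (i + 1)) + p + q = N := by
      refine Eq.trans ?_ htel
      have e1 : p = ∑ i ∈ Finset.range α.length, if i = j then p else 0 := by
        rw [Finset.sum_ite_eq', if_pos (Finset.mem_range.2 (by omega))]
      have e2 : q = ∑ i ∈ Finset.range α.length, if i = j + 1 then q else 0 := by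
        rw [Finset.sum_ite_eq', if_pos (Finset.mem_range.2 (by omega))]
      conv_lhs => rw [e1, e2]
      rw [← Finset.sum_add_distrib, ← Finset.sum_add_distrib]
      refine Finset.sum_congr rfl fun i _ => ?_
      by_cases hi : i = j
      · subst hi
        simp
        omega
      · by_cases hi' : i = j + 1
        · subst hi'
          simp
          omega
        · simp [hi, hi']
    -- After column `j` has lost `p` boxes, the other `m - p` must avoid columns `j` and `j + 1`.
    -- There is room for `N - p - q`, enough because `m ≤ N - q`.
    obtain ⟨g, hg, hgsum⟩ := Finset.exists_le_sum_eq (Finset.range α.length)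
      (fun i => if i = j ∨ i = j + 1 then 0 else lam.colLen i - lam.colLen (i + 1)) (m - p)
      (by omega)
    set f : ℕ → ℕ := fun i => if i = j then lam.colLen (j + 1) else lam.colLen i - g i with hf
    have hfl : ∀ i, f i ≤ lam.colLen i ∧ lam.colLen (i + 1) ≤ f i := by
      intro i
      have h1 := hg i
      have h3 := hanti i
      simp only [hf]
      by_cases hi : i = j
      · rw [if_pos hi, hi]
        exact ⟨hanti j, le_rfl⟩
      · rw [if_neg hi]
        split_ifs at h1 <;> omega
    have hfR : f α.length = 0 := by
      have := hfl α.length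
      omega
    obtain ⟨nu, hnu⟩ : ∃ nu : YoungDiagram, ∀ i, nu.colLen i = f i :=
      ⟨ofColLen f (antitone_nat_of_succ_le fun i => (hfl (i + 1)).1.trans (hfl i).2) α.length,
        colLen_ofColLen hfR⟩
    have hcard : lam.card = nu.card + m := by
      rw [card_eq_sum_colLen lam hlen, card_eq_sum_colLen nu ((hnu _).trans hfR),
        ← Nat.sub_add_cancel h1, ← hgsum]
      have e1 : p = ∑ i ∈ Finset.range α.length, if i = j then p else 0 := by
        rw [Finset.sum_ite_eq', if_pos (Finset.mem_range.2 (by omega))]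
      conv_rhs => rw [e1]
      rw [← Finset.sum_add_distrib, ← Finset.sum_add_distrib]
      refine Finset.sum_congr rfl fun i _ => ?_
      have h1 := hg i
      have h2 := hanti i
      rw [hnu]
      simp only [hf]
      by_cases hi : i = j
      · subst hi
        simp only [true_or, if_true] at h1 ⊢
        omega
      · simp only [hi, false_or, if_false] at h1 ⊢
        split_ifs at h1 <;> omega
    have hmem : nu ∈ lam.removeVerticalStrip m := by
      rw [mem_removeVerticalStrip]
      exact ⟨fun i => by rw [hnu]; exact hfl i, hcard⟩
    have hnuj : nu.colLen j = lam.colLen (j + 1) := by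
      rw [hnu]
      exact if_pos rfl
    have hnuj' : nu.colLen (j + 1) = lam.colLen (j + 1) := by
      have := hg (j + 1)
      simp only [or_true, if_true] at this
      rw [hnu]
      simp only [hf, Nat.succ_ne_self, if_false]
      omega
    -- Columns `j` and `j + 1` of `nu` share the length `lam.colLen (j + 1)`, positive since it is
    -- at least `q`.
    have := (exists_eq_fatStaircase_iff nu).1 (hfat hmem) j (by omega)
    omega
  · intro hno nu hnu
    refine (exists_eq_fatStaircase_iff nu).2 fun j hpos => ?_
    by_contra! hge
    obtain ⟨h1, h2⟩ := mem_removeVerticalStrip.1 (Finset.mem_coe.1 hnu)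
    have hj1 := h1 j
    have hj2 := h1 (j + 1)
    -- The failing inequality squeezes `nu.colLen j`, `nu.colLen (j + 1)` and `lam.colLen (j + 1)`
    -- to one positive value, so column `j` loses its whole block and column `j + 1` nothing.
    have hj : j + 1 < α.length := by
      by_contra! hle
      have := lam.colLen_anti _ _ hle
      omega
    have hb1 := hblock ⟨j, Nat.lt_of_succ_lt hj⟩
    have hb2 := hblock ⟨j + 1, hj⟩
    simp only at hb1 hb2
    have hsum : ∑ i ∈ Finset.range α.length, (lam.colLen i - nu.colLen i) = m := by
      rw [card_eq_sum_colLen lam hlen, card_eq_sum_colLen nu (R := α.length)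
        (by have := (h1 α.length).1; omega)] at h2
      rw [Finset.sum_tsub_distrib _ fun i _ => (h1 i).1]
      omega
    refine hno ⟨j, hj, ?_, ?_⟩
    · have := Finset.single_le_sum (f := fun i => lam.colLen i - nu.colLen i)
        (fun _ _ => Nat.zero_le _) (Finset.mem_range.2 (Nat.lt_of_succ_lt hj))
      omega
    -- All `m` boxes come from columns other than `j + 1`, whose capacities total `N` minus the
    -- block at `j + 1`.
    · have hjm : j + 1 ∈ Finset.range α.length := Finset.mem_range.2 hj
      rw [← Finset.add_sum_erase _ _ hjm] at hsum htel
      have := Finset.sum_le_sum (s := (Finset.range α.length).erase (j + 1))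
        (f := fun i => lam.colLen i - nu.colLen i)
        (g := fun i => lam.colLen i - lam.colLen (i + 1))
        fun i _ => Nat.sub_le_sub_left (h1 i).2 _
      omega
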